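/- Let $V$ be a real vector space of finite dimension $m$. Let $\mathfrak a(V)\subset\otimes^4V^*$ be the space of algebraic curvature tensors on $V$, i.e. of quadrilinear forms $A$ such that for all $x,y,z,w\in V$ $$A(x,y,z,w)=-A(y,x,z,w),\qquad A(x,y,z,w)+A(y,z,x,w)+A(z,x,y,w)=0,$$ $$A(x,y,z,w)=A(z,w,x,y),\qquad A(x,y,z,w)=-A(x,y,w,z).$$ Let $S^2(V^*)$ be the space of symmetric bilinear forms on $V$. For $\phi,\psi\in S^2(V^*)$ define $\phi\wedge\psi\in\mathfrak a(V)$ by $$(\phi\wedge\psi)(x,y,z,w):=\tfrac12\{\phi(x,w)\psi(y,z)-\phi(x,z)\psi(y,w)+\phi(y,z)\psi(x,w)-\phi(y,w)\psi(x,z)\}.$$ Theorem 3.5. (1) If $A\in\mathfrak a(V)$, then there is a finite (possibly empty) collection of elements $\phi_\nu\in S^2(V^*)$ with $\operatorname{Rank}\{\phi_\nu\}=2$ for every $\nu$ such that $A=\sum_\nu\phi_\nu\wedge\phi_\nu$. (2) Let $p,q\ge 0$ be integers with $2\le p+q\le m$, and let $S^2_{(p,q)}(V^*)$ be the set of all (possibly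 degenerate) symmetric bilinear forms on $V$ of signature $(p,q)$, i.e. such that $p$ and $q$ are the maximal dimensions of subspaces on which the form is positive, respectively negative, definite. Then $$\mathfrak a(V)=\operatorname{Span}_{\mathbb R}\{\phi\wedge\phi:\phi\in S^2_{(p,q)}(V^*)\}.$$ -/

import Mathlib

/-- Quadrilinear forms on a real vector space `V`, the elements of `⊗⁴ V*` (for finite-dimensional
`V`), in curried form: the value on `(x, y, z, w)` is `A x y z w`. -/
abbrev QuadrilinForm (V : Type*) [AddCommGroup V] [Module ℝ V] : Type _ :=
  V →ₗ[ℝ] V →ₗ[ℝ] V →ₗ[ℝ] V →ₗ[ℝ] ℝ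

/-- The space `𝔞(V)` of algebraic curvature tensors on `V`. -/
def algCurvTensors (V : Type*) [AddCommGroup V] [Module ℝ V] :
    Submodule ℝ (QuadrilinForm V) where
  carrier := {A | ∀ x y z w : V,
    A x y z w = -A y x z w ∧
    A x y z w + A y z x w + A z x y w = 0 ∧
    A x y z w = A z w x y ∧
    A x y z w = -A x y w z}
  zero_mem' := by
    intro x y z w
    simp
  add_mem' := by
    intro A B hA hB x y z w
    obtain ⟨a1, a2, a3, a4⟩ := hA x y z w
    obtain ⟨b1, b2, b3, b4⟩ := hB x y z w
    simp only [LinearMap.add_apply]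
    refine ⟨?_, ?_, ?_, ?_⟩ <;> linarith
  smul_mem' := by
    intro c A hA x y z w
    obtain ⟨a1, a2, a3, a4⟩ := hA x y z w
    simp only [LinearMap.smul_apply, smul_eq_mul]
    refine ⟨?_, ?_, ?_, ?_⟩
    · rw [a1]; ring
    · linear_combination c * a2
    · rw [a3]
    · rw [a4]; ring

/-- The product `φ ∧ ψ` of two bilinear forms, a quadrilinear form. -/
noncomputable def curvWedge {V : Type*} [AddCommGroup V] [Module ℝ V] (φ ψ : LinearMap.BilinForm ℝ V) :
    QuadrilinForm V :=
  LinearMap.mk₂ ℝ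
    (fun x y => LinearMap.mk₂ ℝ
      (fun z w => (1 / 2 : ℝ) *
        (φ x w * ψ y z - φ x z * ψ y w + φ y z * ψ x w - φ y w * ψ x z))
      (by intros; simp only [map_add]; ring)
      (by intros; simp only [map_smul, smul_eq_mul]; ring)
      (by intros; simp only [map_add]; ring)
      (by intros; simp only [map_smul, smul_eq_mul]; ring))
    (by intros; ext; simp; ring)
    (by intros; ext; simp; ring)
    (by intros; ext; simp; ring)
    (by intros; ext; simp; ring)

theorem curvWedge_apply {V : Type*} [AddCommGroup V] [Module ℝ V]
    (φ ψ : LinearMap.BilinForm ℝ V) (x y z w : V) :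
    curvWedge φ ψ x y z w = (1 / 2 : ℝ) *
      (φ x w * ψ y z - φ x z * ψ y w + φ y z * ψ x w - φ y w * ψ x z) := rfl

theorem curvWedge_mem {V : Type*} [AddCommGroup V] [Module ℝ V]
    {φ ψ : LinearMap.BilinForm ℝ V} (hφ : φ.IsSymm) (hψ : ψ.IsSymm) :
    curvWedge φ ψ ∈ algCurvTensors V := by
  intro x y z w
  simp only [curvWedge_apply]
  refine ⟨by ring, ?_, ?_, by ring⟩
  · rw [hφ.eq z x, hφ.eq y x, hφ.eq z y, hψ.eq z x, hψ.eq y x, hψ.eq z y]; ring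
  · rw [hφ.eq z y, hφ.eq z x, hφ.eq w x, hφ.eq w y, hψ.eq z y, hψ.eq z x, hψ.eq w x, hψ.eq w y]
    ring

/-- The set `S²_{(p,q)}(V*)` of symmetric bilinear forms of signature `(p, q)`, possibly
degenerate: `p` and `q` are the largest dimensions of subspaces on which the form is positive,
respectively negative, definite. -/
def symFormsOfSignature (V : Type*) [AddCommGroup V] [Module ℝ V] (p q : ℕ) :
    Set (LinearMap.BilinForm ℝ V) :=
  {φ | φ.IsSymm ∧ sigPos (LinearMap.BilinMap.toQuadraticMap φ) = p ∧
    sigNeg (LinearMap.BilinMap.toQuadraticMap φ) = q}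

/-! Everything reduces to the tensors `α² ∧ β²`, with `α`, `β` linear forms. Polarizing in both
arguments turns them into products `(αγ) ∧ (βδ)` of symmetric products. Expand `A` in a basis and
replace each monomial by the corresponding polarized tensor: the symmetries of `A` and the Bianchi
identity return a nonzero multiple of `A` (`eq_sum_polarCurv`). For (1), `α² ∧ α² = 0`, so `c • (α²
∧ β²)` is itself the square of a rank-two form. For (2), rescaling two nonzero diagonal weights by
positive factors preserves the signature, and a mixed second difference of the squares isolates `α²
∧ β²`. -/

section CurvatureSpan

set_option maxSynthPendingDepth 6

variable {V : Type*} [AddCommGroup V] [Module ℝ V]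

/-- The square `α ⊗ α` of a linear form, as a bilinear form. -/
noncomputable def dualSquare (α : Module.Dual ℝ V) : LinearMap.BilinForm ℝ V :=
  LinearMap.smulRight α α

@[simp]
theorem dualSquare_apply (α : Module.Dual ℝ V) (x y : V) : dualSquare α x y = α x * α y := by
  simp [dualSquare]

theorem curvWedge_dualSquare_apply (α β : Module.Dual ℝ V) (x y z w : V) :
    curvWedge (dualSquare α) (dualSquare β) x y z w =
      (1 / 2 : ℝ) * ((α x * β y - α y * β x) * (α w * β z - α z * β w)) := by
  simp only [curvWedge_apply, dualSquare_apply]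
  ring

theorem curvWedge_dualSquare_eq_zero {α β : Module.Dual ℝ V}
    (h : ¬ LinearIndependent ℝ ![α, β]) :
    curvWedge (dualSquare α) (dualSquare β) = 0 := by
  rw [LinearIndependent.pair_iff] at h
  push Not at h
  obtain ⟨s, t, hst, hne⟩ := h
  have key : ∀ x y, α x * β y - α y * β x = 0 := by
    intro x y
    have hx : s * α x + t * β x = 0 := by simpa using LinearMap.congr_fun hst x
    have hy : s * α y + t * β y = 0 := by simpa using LinearMap.congr_fun hst y
    by_cases hs : s = 0
    · have ht := hne hs
      subst hs
      have hx' : β x = 0 := by simpa [ht] using hx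
      have hy' : β y = 0 := by simpa [ht] using hy
      simp [hx', hy']
    · refine (mul_eq_zero.mp ?_).resolve_left hs
      linear_combination β y * hx - β x * hy
  ext x y z w
  simp [curvWedge_dualSquare_apply, key]

/-! ### Generation by the tensors `α² ∧ β²` -/

/-- The polarization of `(α, β) ↦ α² ∧ β²` in both arguments. -/
noncomputable def polarCurv (α γ β δ : Module.Dual ℝ V) : QuadrilinForm V :=
  curvWedge (dualSquare (α + γ)) (dualSquare (β + δ)) +
    curvWedge (dualSquare (α - γ)) (dualSquare (β - δ)) -
    (curvWedge (dualSquare (α - γ)) (dualSquare (β + δ)) +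
      curvWedge (dualSquare (α + γ)) (dualSquare (β - δ)))

theorem polarCurv_apply (α γ β δ : Module.Dual ℝ V) (p : V → V → V → V → ℝ)
    (hp : ∀ a b c d, p a b c d = α a * β b * γ c * δ d) (x y z w : V) :
    polarCurv α γ β δ x y z w = -2 *
      (p x y z w - p x y w z - p y x z w + p y x w z
        + p z y x w - p w y x z - p z x y w + p w x y z
        + p x w z y - p x z w y - p y w z x + p y z w x
        + p z w x y - p w z x y - p z w y x + p w z y x) := by
  simp only [hp, polarCurv, LinearMap.add_apply, LinearMap.sub_apply, curvWedge_dualSquare_apply]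
  ring

theorem apply_eq_sum_basis {ι : Type*} [Fintype ι] (b : Module.Basis ι ℝ V) (A : QuadrilinForm V)
    (x y z w : V) :
    A x y z w = ∑ i, ∑ j, ∑ k, ∑ l, A (b i) (b j) (b k) (b l) *
      (b.coord i x * b.coord j y * b.coord k z * b.coord l w) := by
  have expand : ∀ (f : V →ₗ[ℝ] ℝ) (v : V), f v = ∑ i, b.coord i v * f (b i) := fun f v => by
    conv_lhs => rw [← b.sum_repr v]
    simp only [map_sum, map_smul, smul_eq_mul, Module.Basis.coord_apply]
  have hx : ∀ y z w, A x y z w = ∑ i, b.coord i x * A (b i) y z w := fun y z w =>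
    expand (((A.flip y).flip z).flip w) x
  have hy : ∀ i z w, A (b i) y z w = ∑ j, b.coord j y * A (b i) (b j) z w := fun i z w =>
    expand (((A (b i)).flip z).flip w) y
  have hz : ∀ i j w, A (b i) (b j) z w = ∑ k, b.coord k z * A (b i) (b j) (b k) w := fun i j w =>
    expand ((A (b i) (b j)).flip w) z
  have hw : ∀ i j k, A (b i) (b j) (b k) w = ∑ l, b.coord l w * A (b i) (b j) (b k) (b l) :=
    fun i j k => expand (A (b i) (b j) (b k)) w
  rw [hx]
  refine Finset.sum_congr rfl fun i _ => ?_
  rw [hy, Finset.mul_sum]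
  refine Finset.sum_congr rfl fun j _ => ?_
  rw [hz, Finset.mul_sum, Finset.mul_sum]
  refine Finset.sum_congr rfl fun k _ => ?_
  rw [hw, Finset.mul_sum, Finset.mul_sum, Finset.mul_sum]
  refine Finset.sum_congr rfl fun l _ => ?_
  ring

theorem eq_sum_polarCurv {ι : Type*} [Fintype ι] (b : Module.Basis ι ℝ V) {A : QuadrilinForm V}
    (hA : A ∈ algCurvTensors V) :
    A = ∑ i, ∑ j, ∑ k, ∑ l, (-(1 / 24) * A (b i) (b j) (b k) (b l)) •
      polarCurv (b.coord i) (b.coord k) (b.coord j) (b.coord l) := by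
  ext x y z w
  simp only [LinearMap.sum_apply, LinearMap.smul_apply, smul_eq_mul]
  -- Keeping `p` opaque lets each of the sixteen permuted sums match `hsum`.
  obtain ⟨p, hp⟩ : ∃ p : ι → ι → ι → ι → V → V → V → V → ℝ, ∀ i j k l x y z w,
      p i j k l x y z w = A (b i) (b j) (b k) (b l) *
        (b.coord i x * b.coord j y * b.coord k z * b.coord l w) := ⟨_, fun _ _ _ _ _ _ _ _ => rfl⟩
  have hsum : ∀ x y z w, ∑ i, ∑ j, ∑ k, ∑ l, p i j k l x y z w = A x y z w := fun x y z w => by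
    simp only [hp, ← apply_eq_sum_basis b A]
  have key : ∀ i j k l, (-(1 / 24) * A (b i) (b j) (b k) (b l)) *
      polarCurv (b.coord i) (b.coord k) (b.coord j) (b.coord l) x y z w = 1 / 12 *
      (p i j k l x y z w - p i j k l x y w z - p i j k l y x z w + p i j k l y x w z
        + p i j k l z y x w - p i j k l w y x z - p i j k l z x y w + p i j k l w x y z
        + p i j k l x w z y - p i j k l x z w y - p i j k l y w z x + p i j k l y z w x
        + p i j k l z w x y - p i j k l w z x y - p i j k l z w y x + p i j k l w z y x) := by
    intro i j k l
    rw [polarCurv_apply _ _ _ _ _ (fun _ _ _ _ => rfl)]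
    simp only [hp]
    ring
  simp only [key, ← Finset.mul_sum]
  simp only [Finset.sum_add_distrib, Finset.sum_sub_distrib, hsum]
  have h1 : ∀ x y z w, A x y z w = -A y x z w := fun x y z w => (hA x y z w).1
  have h2 : ∀ x y z w, A x y z w + A y z x w + A z x y w = 0 := fun x y z w => (hA x y z w).2.1
  have h3 : ∀ x y z w, A x y z w = A z w x y := fun x y z w => (hA x y z w).2.2.1
  have h4 : ∀ x y z w, A x y z w = -A x y w z := fun x y z w => (hA x y z w).2.2.2
  -- Eight of the sixteen terms equal `A x y z w` by the pair and sign symmetries. The other eight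
  -- add up to `4 * A x y z w` by Bianchi, giving 12 in all.
  grind

/-- An additive submonoid suffices because `c` may be negative; (1) needs this, since its sums carry
no coefficients. -/
theorem mem_of_curvWedge_dualSquare_mem [FiniteDimensional ℝ V] (N : AddSubmonoid (QuadrilinForm V))
    (hN : ∀ (c : ℝ) (α β : Module.Dual ℝ V), LinearIndependent ℝ ![α, β] →
      c • curvWedge (dualSquare α) (dualSquare β) ∈ N)
    {A : QuadrilinForm V} (hA : A ∈ algCurvTensors V) : A ∈ N := by
  have hN' : ∀ (c : ℝ) (α β : Module.Dual ℝ V),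
      c • curvWedge (dualSquare α) (dualSquare β) ∈ N := by
    intro c α β
    by_cases h : LinearIndependent ℝ ![α, β]
    · exact hN c α β h
    · rw [curvWedge_dualSquare_eq_zero h, smul_zero]
      exact N.zero_mem
  rw [eq_sum_polarCurv (Module.finBasis ℝ V) hA]
  refine sum_mem fun i _ => sum_mem fun j _ => sum_mem fun k _ => sum_mem fun l _ => ?_
  rw [polarCurv, smul_sub, sub_eq_add_neg, ← neg_smul, smul_add, smul_add]
  exact add_mem (add_mem (hN' _ _ _) (hN' _ _ _)) (add_mem (hN' _ _ _) (hN' _ _ _))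

/-- Two linearly independent linear forms are coordinates of some linear isomorphism with a
coordinate space. -/
theorem exists_coordinates [FiniteDimensional ℝ V] {α β : Module.Dual ℝ V}
    (h : LinearIndependent ℝ ![α, β]) :
    ∃ (n : ℕ) (i j : Fin n) (E : V ≃ₗ[ℝ] (Fin n → ℝ)), i ≠ j ∧
      (∀ v, E v i = α v) ∧ (∀ v, E v j = β v) := by
  let B := Module.Basis.sumExtend h
  have : Finite (Fin 2 ⊕ Module.Basis.sumExtendIndex h) := Module.Finite.finite_basis B
  obtain ⟨n, ⟨e⟩⟩ := Finite.exists_equiv_fin (Fin 2 ⊕ Module.Basis.sumExtendIndex h)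
  have hB : ∀ k, B (Sum.inl k) = ![α, β] k := fun k => by
    simp [B, Module.Basis.sumExtend]
    rfl
  let C := B.reindex e
  -- A vector is sent to its evaluation functional, read off on the basis `C` of the dual.
  let E := (Module.evalEquiv ℝ V).trans (C.constr ℝ).symm
  have hE : ∀ v k, E v k = C k v := fun v k => by
    simp [E, Module.Basis.constr]
  refine ⟨n, e (Sum.inl 0), e (Sum.inl 1), E, by simp, fun v => ?_, fun v => ?_⟩
  · simp [hE, C, hB]
  · simp [hE, C, hB]

/-! ### Squares of rank-two forms -/

theorem finrank_range_diag [FiniteDimensional ℝ V] {α β : Module.Dual ℝ V}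
    (h : LinearIndependent ℝ ![α, β]) {a b : ℝ} (ha : a ≠ 0) (hb : b ≠ 0) :
    Module.finrank ℝ (LinearMap.range (a • dualSquare α + b • dualSquare β)) = 2 := by
  have hr : LinearMap.range (a • dualSquare α + b • dualSquare β) =
      Submodule.span ℝ (Set.range ![α, β]) := by
    obtain ⟨n, i, j, E, hij, hi, hj⟩ := exists_coordinates h
    apply le_antisymm
    · rintro _ ⟨x, rfl⟩
      have : (a • dualSquare α + b • dualSquare β) x = (a * α x) • α + (b * β x) • β := by
        ext y
        simp [mul_assoc]
      rw [this]
      exact add_mem (Submodule.smul_mem _ _ (Submodule.subset_span ⟨0, rfl⟩))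
        (Submodule.smul_mem _ _ (Submodule.subset_span ⟨1, rfl⟩))
    · rw [Submodule.span_le]
      rintro _ ⟨k, rfl⟩
      fin_cases k
      · refine ⟨E.symm (Pi.single i a⁻¹), ?_⟩
        ext y
        simp [← hi, ← hj, hij.symm, ha]
      · refine ⟨E.symm (Pi.single j b⁻¹), ?_⟩
        ext y
        simp [← hi, ← hj, hij, hb]
  rw [hr, finrank_span_eq_card h, Fintype.card_fin]

theorem exists_sum_curvWedge_of_mem [FiniteDimensional ℝ V] {A : QuadrilinForm V}
    (hA : A ∈ algCurvTensors V) :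
    ∃ (k : ℕ) (φ : Fin k → LinearMap.BilinForm ℝ V),
      (∀ ν, (φ ν).IsSymm ∧ Module.finrank ℝ (LinearMap.range (φ ν)) = 2) ∧
      A = ∑ ν, curvWedge (φ ν) (φ ν) := by
  let S : Set (QuadrilinForm V) := {T | ∃ φ : LinearMap.BilinForm ℝ V,
    (φ.IsSymm ∧ Module.finrank ℝ (LinearMap.range φ) = 2) ∧ T = curvWedge φ φ}
  have hmem : A ∈ AddSubmonoid.closure S := by
    refine mem_of_curvWedge_dualSquare_mem _ (fun c α β h => ?_) hA
    by_cases hc : c = 0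
    · rw [hc, zero_smul]
      exact zero_mem _
    -- The pure squares vanish and the cross term occurs twice, hence `c / 2`.
    refine AddSubmonoid.subset_closure ⟨(1 : ℝ) • dualSquare α + (c / 2) • dualSquare β,
      ⟨⟨fun x y => by simp; ring⟩, finrank_range_diag h one_ne_zero (by simpa using hc)⟩, ?_⟩
    ext x y z w
    simp [curvWedge_apply]
    ring
  obtain ⟨l, hl, rfl⟩ := AddSubmonoid.exists_list_of_mem_closure hmem
  choose φ hφ hT using fun ν : Fin l.length => hl (l.get ν) (l.get_mem ν)
  refine ⟨l.length, φ, hφ, ?_⟩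
  simp only [← hT]
  simp

/-! ### Forms of prescribed signature -/

/-- The diagonal bilinear form with weights `w` in the coordinates `E`. -/
noncomputable def diagForm {n : ℕ} (E : V ≃ₗ[ℝ] (Fin n → ℝ)) (w : Fin n → ℝ) :
    LinearMap.BilinForm ℝ V :=
  ∑ k, w k • dualSquare (LinearMap.proj k ∘ₗ E.toLinearMap)

theorem diagForm_apply {n : ℕ} (E : V ≃ₗ[ℝ] (Fin n → ℝ)) (w : Fin n → ℝ) (x y : V) :
    diagForm E w x y = ∑ k, w k * (E x k * E y k) := by
  simp [diagForm]

theorem diagForm_mem_symFormsOfSignature {n : ℕ} (E : V ≃ₗ[ℝ] (Fin n → ℝ)) (w : Fin n → ℝ) :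
    diagForm E w ∈ symFormsOfSignature V {k | 0 < w k}.ncard {k | w k < 0}.ncard := by
  have e : (LinearMap.BilinMap.toQuadraticMap (diagForm E w)).Equivalent
      (QuadraticMap.weightedSumSquares ℝ w) :=
    ⟨⟨E, fun v => by simp [QuadraticMap.weightedSumSquares_apply, diagForm_apply]⟩⟩
  refine ⟨⟨fun x y => ?_⟩, QuadraticForm.sigPos_of_equiv_weightedSumSquares e,
    QuadraticForm.sigNeg_of_equiv_weightedSumSquares e⟩
  simp [diagForm_apply, mul_comm (E x _)]

theorem exists_weights {n p q : ℕ} (h2 : 2 ≤ p + q) (hn : p + q ≤ n) {i j : Fin n} (hij : i ≠ j) :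
    ∃ w : Fin n → ℝ, w i ≠ 0 ∧ w j ≠ 0 ∧
      {k | 0 < w k}.ncard = p ∧ {k | w k < 0}.ncard = q := by
  classical
  obtain ⟨S, hS, hSc⟩ := Finset.exists_superset_card_eq (s := {i, j}) (n := p + q)
    (by rwa [Finset.card_pair hij]) (by simpa using hn)
  obtain ⟨P, hP, hPc⟩ := Finset.exists_subset_card_eq (s := S) (n := p) (by omega)
  have hi : i ∈ S := hS (by simp)
  have hj : j ∈ S := hS (by simp)
  -- `S` is the support, forced to contain `i` and `j`; `P` carries the positive weights.
  refine ⟨fun k => if k ∈ P then 1 else if k ∈ S then -1 else 0, ?_, ?_, ?_, ?_⟩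
  · dsimp only; split_ifs <;> norm_num
  · dsimp only; split_ifs <;> norm_num
  · rw [← hPc, ← Set.ncard_coe_finset]
    congr 1
    ext k
    simp only [Set.mem_ofPred_eq, Finset.mem_coe]
    split_ifs with h1 h2 <;> simp [h1]
  · have : (S \ P).card = q := by
      rw [Finset.card_sdiff_of_subset hP]
      omega
    rw [← this, ← Set.ncard_coe_finset]
    congr 1
    ext k
    simp only [Set.mem_ofPred_eq, Finset.mem_coe, Finset.mem_sdiff]
    split_ifs with h1 h2 <;> simp [h1, h2]

theorem algCurvTensors_le_span [FiniteDimensional ℝ V] {p q : ℕ} (h2 : 2 ≤ p + q)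
    (hm : p + q ≤ Module.finrank ℝ V) :
    algCurvTensors V ≤
      Submodule.span ℝ {T | ∃ φ ∈ symFormsOfSignature V p q, T = curvWedge φ φ} := by
  intro A hA
  refine mem_of_curvWedge_dualSquare_mem (Submodule.toAddSubmonoid _) (fun c α β h => ?_) hA
  refine Submodule.smul_mem _ c ?_
  obtain ⟨n, i, j, E, hij, hi, hj⟩ := exists_coordinates h
  have hn : Module.finrank ℝ V = n := by simpa using E.finrank_eq
  obtain ⟨w, hwi, hwj, hwp, hwq⟩ := exists_weights h2 (hm.trans hn.le) hij
  have hmem : ∀ s t : ℝ, 0 ≤ s → 0 ≤ t →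
      curvWedge (diagForm E w + (s * w i) • dualSquare α + (t * w j) • dualSquare β)
        (diagForm E w + (s * w i) • dualSquare α + (t * w j) • dualSquare β) ∈
      Submodule.span ℝ {T | ∃ φ ∈ symFormsOfSignature V p q, T = curvWedge φ φ} := by
    intro s t hs ht
    refine Submodule.subset_span ⟨_, ?_, rfl⟩
    -- The perturbation multiplies weight `i` by `1 + s` and weight `j` by `1 + t`, so no sign
    -- changes.
    let r : Fin n → ℝ := fun k => 1 + (Pi.single i s : Fin n → ℝ) k + (Pi.single j t : Fin n → ℝ) k
    have hr : ∀ k, 0 < r k := fun k => by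
      have h1 : (0 : Fin n → ℝ) ≤ Pi.single i s := Pi.single_nonneg.mpr hs
      have h2 : (0 : Fin n → ℝ) ≤ Pi.single j t := Pi.single_nonneg.mpr ht
      have h1 := h1 k
      have h2 := h2 k
      simp only [Pi.zero_apply] at h1 h2
      simp only [r]
      linarith
    have heq : diagForm E w + (s * w i) • dualSquare α + (t * w j) • dualSquare β =
        diagForm E (fun k => r k * w k) := by
      ext x y
      simp [diagForm_apply, r, add_mul, Finset.sum_add_distrib, Pi.single_apply, hi, hj, mul_assoc]
    rw [heq, ← hwp, ← hwq]
    convert diagForm_mem_symFormsOfSignature E (fun k => r k * w k) using 4 with k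
    · simp [hr]
    · simp [mul_neg_iff, hr, (hr _).not_gt]
  -- The square is quadratic in `(s, t)`; its mixed difference over `{0, 1}²` keeps only the `s * t`
  -- term, `2 * (w i * w j)` times `α² ∧ β²`.
  have hkey : curvWedge (dualSquare α) (dualSquare β) = (1 / (2 * (w i * w j))) •
      (curvWedge (diagForm E w + ((1 : ℝ) * w i) • dualSquare α + ((1 : ℝ) * w j) • dualSquare β)
        (diagForm E w + ((1 : ℝ) * w i) • dualSquare α + ((1 : ℝ) * w j) • dualSquare β) -
      curvWedge (diagForm E w + ((1 : ℝ) * w i) • dualSquare α + ((0 : ℝ) * w j) • dualSquare β)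
        (diagForm E w + ((1 : ℝ) * w i) • dualSquare α + ((0 : ℝ) * w j) • dualSquare β) -
      curvWedge (diagForm E w + ((0 : ℝ) * w i) • dualSquare α + ((1 : ℝ) * w j) • dualSquare β)
        (diagForm E w + ((0 : ℝ) * w i) • dualSquare α + ((1 : ℝ) * w j) • dualSquare β) +
      curvWedge (diagForm E w + ((0 : ℝ) * w i) • dualSquare α + ((0 : ℝ) * w j) • dualSquare β)
        (diagForm E w + ((0 : ℝ) * w i) • dualSquare α + ((0 : ℝ) * w j) • dualSquare β)) := by
    ext x y z u
    simp only [curvWedge_apply, LinearMap.smul_apply, LinearMap.add_apply, LinearMap.sub_apply,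
      smul_eq_mul, dualSquare_apply]
    field_simp
    ring
  rw [hkey]
  exact Submodule.smul_mem _ _ (add_mem (sub_mem (sub_mem
    (hmem 1 1 zero_le_one zero_le_one) (hmem 1 0 zero_le_one le_rfl))
    (hmem 0 1 le_rfl zero_le_one)) (hmem 0 0 le_rfl le_rfl))

end CurvatureSpan

theorem theorem3p5 (V : Type*) [AddCommGroup V] [Module ℝ V] [FiniteDimensional ℝ V] :
    (∀ A ∈ algCurvTensors V, ∃ (k : ℕ) (φ : Fin k → LinearMap.BilinForm ℝ V),
      (∀ ν, (φ ν).IsSymm ∧ Module.finrank ℝ (LinearMap.range (φ ν)) = 2) ∧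
      A = ∑ ν, curvWedge (φ ν) (φ ν)) ∧
    (∀ p q : ℕ, 2 ≤ p + q → p + q ≤ Module.finrank ℝ V →
      algCurvTensors V =
        Submodule.span ℝ {T | ∃ φ ∈ symFormsOfSignature V p q, T = curvWedge φ φ}) := by
  refine ⟨fun A hA => exists_sum_curvWedge_of_mem hA, fun p q h2 hm =>
    le_antisymm (algCurvTensors_le_span h2 hm) (Submodule.span_le.mpr ?_)⟩
  rintro _ ⟨φ, hφ, rfl⟩
  exact curvWedge_mem hφ.1 hφ.1
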